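/- Let $X$ be a (non-empty) proper CAT(0) space, i.e. a geodesic metric space in which closed balls are compact and every geodesic triangle is at least as thin as its Euclidean comparison triangle. Let $\partial X$ be its visual boundary (asymptotism classes of unit speed geodesic rays), and give $X\cup\partial X$ the cone topology and $\partial X$ the subspace topology. For $a,b\in\partial X$ let $\angle(a,b)=\sup_{x\in X}\angle_x(a,b)$, let $d_T$ be the Tits metric, i.e. the (possibly infinite) path metric on $\partial X$ induced by $\angle$, and let $\bar B_T(a,\theta)=\{\xi\in\partial X : d_T(a,\xi)\le\theta\}$. Let $G$ be a group acting by isometries on $X$, properly in the sense that $\{g\in G : gK\cap K\neq\emptyset\}$ is finite for every compact $K\subset X$. For a sequence $(g_i)$ in $G$ and $n,p\in\partial X$, consider the property $(\ast)$ for every $\theta\in[0,\pi]$, every compact $K\subset\partial X\setminus\bar B_T(n,\theta)$ and every open $U\subset\partial X$ with $U\supset\bar B_T(p,\pi-\theta)$, one has $g_i(K)\subset U$ for all sufficiently large $i$. Then: (1) If $x\in X$, $n,p\in\partial X$ and $(g_i)$ is a sequence in $G$ with $g_i(x)\to p$ and $g_i^{-1}(x)\to n$ in $X\cup\partial X$,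 then $(\ast)$ holds for $(g_i)$, $n$, $p$. (2) Every sequence of distinct elements of $G$ has a subsequence $(g_i)$ for which there are points $n,p\in\partial X$ such that $(\ast)$ holds for $(g_i)$, $n$, $p$. -/

import Mathlib

open Filter Topology Set
open scoped NNReal ENNReal

namespace CATZero

/-- The Euclidean plane. -/
abbrev Plane : Type := EuclideanSpace ℝ (Fin 2)

section Geodesics

variable {X : Type*} [MetricSpace X]

/-- `γ`, restricted to `[0, dist x y]`, is a unit speed geodesic segment from `x` to `y`. -/
def IsGeodesicSegment (γ : ℝ → X) (x y : X) : Prop :=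
  γ 0 = x ∧ γ (dist x y) = y ∧
    ∀ s ∈ Icc 0 (dist x y), ∀ t ∈ Icc 0 (dist x y), dist (γ s) (γ t) = |s - t|

variable (X) in
/-- The CAT(0) condition: `X` is a geodesic space and every geodesic triangle is at least as thin as
its comparison triangle in the Euclidean plane.  Two points on different sides of a triangle lie
on two sides with a common vertex, here called `x`. -/
structure IsCAT0 : Prop where
  exists_geodesic : ∀ x y : X, ∃ γ : ℝ → X, IsGeodesicSegment γ x y
  thin : ∀ (x y z : X) (α β : ℝ → X), IsGeodesicSegment α x y → IsGeodesicSegment β x z →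
    ∀ x' y' z' : Plane, dist x' y' = dist x y → dist x' z' = dist x z → dist y' z' = dist y z →
    ∀ s ∈ Icc 0 (dist x y), ∀ t ∈ Icc 0 (dist x z),
    ∀ p' ∈ segment ℝ x' y', ∀ q' ∈ segment ℝ x' z', dist x' p' = s → dist x' q' = t →
      dist (α s) (β t) ≤ dist p' q'

end Geodesics

section Boundary

variable (X : Type*) [MetricSpace X]

/-- Unit speed geodesic rays `[0, ∞) → X`. -/
abbrev Ray : Type _ := {R : ℝ≥0 → X // Isometry R}

/-- Two rays are equivalent (asymptotic) if they stay at bounded distance. -/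
instance raySetoid : Setoid (Ray X) where
  r R S := ∃ C : ℝ, ∀ t, dist (R.1 t) (S.1 t) ≤ C
  iseqv :=
    { refl := fun R => ⟨0, fun t => by simp⟩
      symm := by
        rintro R S ⟨C, h⟩
        exact ⟨C, fun t => by rw [dist_comm]; exact h t⟩
      trans := by
        rintro R S T ⟨C, h⟩ ⟨D, k⟩
        exact ⟨C + D, fun t => (dist_triangle _ (S.1 t) _).trans (add_le_add (h t) (k t))⟩ }

/-- The boundary `∂X`: equivalence classes of geodesic rays. -/
def Boundary : Type _ := Quotient (raySetoid X)

variable {X}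

/-- The endpoint in `∂X` of a ray. -/
def Ray.endpoint (R : Ray X) : Boundary X := Quotient.mk (raySetoid X) R

/-- The image of a ray under a group element acting by isometries. -/
def Ray.translate {G : Type*} [Group G] [MulAction G X] [IsIsometricSMul G X]
    (g : G) (R : Ray X) : Ray X :=
  ⟨fun t => g • R.1 t, (isometry_smul X g).comp R.2⟩

/-- The action on `∂X` induced by an isometric action on `X`. -/
instance {G : Type*} [Group G] [MulAction G X] [IsIsometricSMul G X] :
    MulAction G (Boundary X) where
  smul g := Quotient.map (Ray.translate g) (by
    rintro R S ⟨C, h⟩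
    exact ⟨C, fun t => by simpa [Ray.translate] using h t⟩)
  one_smul ξ := by
    induction ξ using Quotient.inductionOn with
    | _ R => exact congrArg (Quotient.mk (raySetoid X)) (Subtype.ext (funext fun t => one_smul G _))
  mul_smul g h ξ := by
    induction ξ using Quotient.inductionOn with
    | _ R =>
      exact congrArg (Quotient.mk (raySetoid X)) (Subtype.ext (funext fun t => mul_smul g h _))

theorem smul_endpoint {G : Type*} [Group G] [MulAction G X] [IsIsometricSMul G X]
    (g : G) (R : Ray X) : g • Ray.endpoint R = Ray.endpoint (Ray.translate g R) := rfl

variable (X) in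
/-- The underlying set of the visual compactification `X ∪ ∂X`. -/
inductive Bordification : Type _
  | pt : X → Bordification
  | bd : Boundary X → Bordification

/-- The basic set `U(R, r, ε)`, with base point `o`: the points `z` of `X ∪ ∂X`
such that the unit speed geodesic `S` from `o` to `z` is defined beyond time `r`
and satisfies `dist (R r) (S r) < ε`. -/
def coneNhd (o : X) (R : Ray X) (r : ℝ≥0) (ε : ℝ) : Set (Bordification X)
  | .pt z => (r : ℝ) < dist o z ∧
      ∃ S : ℝ → X, IsGeodesicSegment S o z ∧ dist (R.1 r) (S r) < ε
  | .bd ξ => ∃ S : Ray X, S.1 0 = o ∧ Ray.endpoint S = ξ ∧ dist (R.1 r) (S.1 r) < ε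

/-- The cone topology on `X ∪ ∂X` with base point `o`, generated by the open balls of `X`
and the sets `U(R, r, ε)` for rays `R` issuing from `o`. -/
@[reducible] def coneTopology (o : X) : TopologicalSpace (Bordification X) :=
  TopologicalSpace.generateFrom
    ({V | ∃ (x : X) (ε : ℝ), 0 < ε ∧ V = Bordification.pt '' Metric.ball x ε} ∪
     {V | ∃ (R : Ray X) (r : ℝ≥0) (ε : ℝ), R.1 0 = o ∧ 0 < r ∧ 0 < ε ∧ V = coneNhd o R r ε})

/-- The visual topology on `∂X`: the subspace topology from `X ∪ ∂X`. -/
@[reducible] def visualTopology (o : X) : TopologicalSpace (Boundary X) :=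
  (coneTopology o).induced Bordification.bd

end Boundary

section Tits

variable {X : Type*} [MetricSpace X]

/-- The comparison angle at `p` of the triangle `p, a, b`, by the law of cosines. -/
noncomputable def comparisonAngle (p a b : X) : ℝ :=
  Real.arccos ((dist p a ^ 2 + dist p b ^ 2 - dist a b ^ 2) / (2 * dist p a * dist p b))

/-- `comparisonAngle` is the angle at the vertex `p'` of any comparison triangle in the plane. -/
theorem comparisonAngle_eq (p a b : X) (p' a' b' : Plane) (ha : dist p' a' = dist p a)
    (hb : dist p' b' = dist p b) (hab : dist a' b' = dist a b) :
    comparisonAngle p a b = EuclideanGeometry.angle a' p' b' := by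
  have h1 : ‖a' - p'‖ = dist p a := by rw [← ha, dist_comm, dist_eq_norm]
  have h2 : ‖b' - p'‖ = dist p b := by rw [← hb, dist_comm, dist_eq_norm]
  have h3 : ‖(a' - p') - (b' - p')‖ = dist a b := by rw [← hab, dist_eq_norm]; congr 1; abel
  unfold comparisonAngle EuclideanGeometry.angle InnerProductGeometry.angle
  rw [vsub_eq_sub, vsub_eq_sub,
    real_inner_eq_norm_mul_self_add_norm_mul_self_sub_norm_sub_mul_self_div_two, h1, h2, h3]
  congr 1
  rw [div_div]
  congr 1 <;> ring

/-- The (Alexandrov) angle between two rays issuing from the same point. -/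
noncomputable def rayAngle (R S : Ray X) : ℝ :=
  limsup (fun q : ℝ≥0 × ℝ≥0 => comparisonAngle (R.1 0) (R.1 q.1) (S.1 q.2))
    (𝓝[>] (0 : ℝ≥0) ×ˢ 𝓝[>] (0 : ℝ≥0))

/-- The angle `∠(a, b) = sup_{x ∈ X} ∠_x(a, b)` between two boundary points, where `∠_x(a, b)` is
the angle at `x` between the rays from `x` to `a` and from `x` to `b`. -/
noncomputable def angle (a b : Boundary X) : ℝ :=
  sSup {α | ∃ R S : Ray X, R.1 0 = S.1 0 ∧ Ray.endpoint R = a ∧ Ray.endpoint S = b ∧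
    α = rayAngle R S}

/-- Continuity of a path in `∂X` with respect to the angle metric. -/
def IsAnglePath (c : unitInterval → Boundary X) : Prop :=
  ∀ t, Tendsto (fun s => angle (c t) (c s)) (𝓝 t) (𝓝 0)

/-- The length of a path in `∂X` with respect to the angle metric. -/
noncomputable def angleLength (c : unitInterval → Boundary X) : ℝ≥0∞ :=
  ⨆ (m : ℕ) (u : ℕ → unitInterval) (_ : Monotone u),
    ∑ i ∈ Finset.range m, ENNReal.ofReal (angle (c (u i)) (c (u (i + 1))))

/-- The Tits metric: the path metric induced by the angle metric
(with value `∞` if there is no path of finite length). -/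
noncomputable def titsDist (a b : Boundary X) : ℝ≥0∞ :=
  ⨅ (c : unitInterval → Boundary X) (_ : IsAnglePath c) (_ : c 0 = a) (_ : c 1 = b), angleLength c

/-- The closed Tits ball with centre `a` and radius `θ`. -/
def closedTitsBall (a : Boundary X) (θ : ℝ) : Set (Boundary X) :=
  {ξ | titsDist a ξ ≤ ENNReal.ofReal θ}

end Tits

section Actions

variable {X : Type*} [MetricSpace X]

variable (X) in
/-- A proper action: every compact set meets only finitely many of its translates. -/
def IsProperAction (G : Type*) [Group G] [MulAction G X] : Prop :=
  ∀ K : Set X, IsCompact K → {g : G | (((fun x => g • x) '' K) ∩ K).Nonempty}.Finite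

/-- For every `θ ∈ [0, π]` and every compact `K ⊆ ∂X` outside the closed Tits ball `B(n, θ)`, the
sets `g i (K)` eventually lie in any open set containing the closed Tits ball `B(p, π - θ)`.
Compactness and openness refer to the visual topology on `∂X`. -/
def PiConverges (o : X) {G : Type*} [Group G] [MulAction G X] [IsIsometricSMul G X]
    (g : ℕ → G) (n p : Boundary X) : Prop :=
  ∀ θ ∈ Icc 0 Real.pi, ∀ K : Set (Boundary X), @IsCompact _ (visualTopology o) K →
    Disjoint K (closedTitsBall n θ) →
    ∀ U : Set (Boundary X), IsOpen[visualTopology o] U → closedTitsBall p (Real.pi - θ) ⊆ U →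
      ∀ᶠ i in atTop, (fun ξ => g i • ξ) '' K ⊆ U

end Actions

end CATZero

namespace CATZero

/-! ### Euclidean comparison triangles. -/

section Comparison

/-! The constant π comes from a Euclidean triangle. For a ray `R` from `o`, the comparison angles of
the triangle `o`, `g⁻¹ • o`, `R T` at `o` and at `g⁻¹ • o` add up to at most π. Applying `g` turns
the second into the angle at `o` between `g • o` and `g • R T`. In a CAT(0) space comparison angles
shrink when points slide towards the vertex, so the bound survives at fixed times and then in the
limit `T → ∞` (`comparisonAngle_add_comparisonAngle_le`).

If convergence fails, compactness gives bad points of `K` with a limit `Q` in `K` whose images have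
a limit `F` outside `U`. The inequality passes to the limit: the angle `a` at infinity between `n`
and `Q` and the angle `b` between `p` and `F` satisfy `a + b ≤ π`. Yet `Q` is farther than `θ` from
`n`, and `F` farther than `π - θ` from `p`, in the Tits metric. This is a contradiction once Tits
distance is bounded by the angle at infinity whenever the latter is below π (`AngleLE.titsDist_le`);
no lower bound on Tits distance is needed.

For that bound, rays at angle less than π are joined by a path at infinity: bisect repeatedly using
limits of midpoints, then take a limit of the dyadic chains. Part (2) follows since properness sends
orbits to infinity, where subsequences converge. -/

theorem Plane.exists_unit_pair {κ : ℝ} (h₁ : -1 ≤ κ) (h₂ : κ ≤ 1) :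
    ∃ u v : Plane, ‖u‖ = 1 ∧ ‖v‖ = 1 ∧ inner ℝ u v = κ := by
  have h : 0 ≤ 1 - κ ^ 2 := by nlinarith
  refine ⟨!₂[1, 0], !₂[κ, √(1 - κ ^ 2)], ?_, ?_, ?_⟩
  · simp [EuclideanSpace.norm_eq, Fin.sum_univ_two]
  · simp [EuclideanSpace.norm_eq, Fin.sum_univ_two, Real.sq_sqrt h]
  · simp [PiLp.inner_apply, Fin.sum_univ_two]

theorem Plane.dist_smul_smul_sq {u v : Plane} (hu : ‖u‖ = 1) (hv : ‖v‖ = 1) (s t : ℝ) :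
    dist (s • u) (t • v) ^ 2 = s ^ 2 + t ^ 2 - 2 * s * t * inner ℝ u v := by
  rw [dist_eq_norm, norm_sub_sq_real, norm_smul, norm_smul, hu, hv, inner_smul_left,
    inner_smul_right]
  simp only [mul_one, Real.norm_eq_abs, sq_abs, conj_trivial]
  ring

theorem smul_mem_segment_zero (u : Plane) {s a : ℝ} (hs : s ∈ Icc 0 a) :
    s • u ∈ segment ℝ 0 (a • u) := by
  rcases eq_or_lt_of_le (hs.1.trans hs.2) with h | h
  · have : s = 0 := le_antisymm (h ▸ hs.2) hs.1
    simp [this, left_mem_segment]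
  · rw [segment_eq_image]
    refine ⟨s / a, ⟨div_nonneg hs.1 h.le, div_le_one_of_le₀ hs.2 h.le⟩, ?_⟩
    beta_reduce
    rw [smul_zero, zero_add, smul_smul, div_mul_cancel₀ _ h.ne']

variable {X : Type*} [MetricSpace X]

/-- The cosine of the comparison angle at `x` of the triangle `x, y, z`. -/
noncomputable def comparisonCos (x y z : X) : ℝ :=
  (dist x y ^ 2 + dist x z ^ 2 - dist y z ^ 2) / (2 * dist x y * dist x z)

theorem comparisonAngle_def (x y z : X) : comparisonAngle x y z = Real.arccos (comparisonCos x y z) :=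
  rfl

theorem comparisonCos_mul {x y z : X} (hxy : 0 < dist x y) (hxz : 0 < dist x z) :
    2 * dist x y * dist x z * comparisonCos x y z =
      dist x y ^ 2 + dist x z ^ 2 - dist y z ^ 2 := by
  unfold comparisonCos
  field_simp

theorem neg_one_le_comparisonCos {x y z : X} (hxy : 0 < dist x y) (hxz : 0 < dist x z) :
    -1 ≤ comparisonCos x y z := by
  unfold comparisonCos
  rw [le_div_iff₀ (by positivity)]
  have h := dist_triangle_left y z x
  nlinarith [dist_nonneg (x := y) (y := z)]

theorem comparisonCos_le_one {x y z : X} (hxy : 0 < dist x y) (hxz : 0 < dist x z) :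
    comparisonCos x y z ≤ 1 := by
  unfold comparisonCos
  rw [div_le_one (by positivity)]
  have h₁ := dist_triangle x y z
  have h₂ := dist_triangle_right x y z
  have : |dist x y - dist x z| ≤ dist y z := abs_le.2 ⟨by linarith, by linarith⟩
  nlinarith [sq_abs (dist x y - dist x z), abs_nonneg (dist x y - dist x z)]

theorem cos_comparisonAngle {x y z : X} (hxy : 0 < dist x y) (hxz : 0 < dist x z) :
    Real.cos (comparisonAngle x y z) = comparisonCos x y z :=
  Real.cos_arccos (neg_one_le_comparisonCos hxy hxz) (comparisonCos_le_one hxy hxz)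

theorem exists_comparison_vectors {x y z : X} (hxy : 0 < dist x y) (hxz : 0 < dist x z) :
    ∃ u v : Plane, ‖u‖ = 1 ∧ ‖v‖ = 1 ∧ inner ℝ u v = comparisonCos x y z ∧
      dist (0 : Plane) (dist x y • u) = dist x y ∧ dist (0 : Plane) (dist x z • v) = dist x z ∧
      dist (dist x y • u) (dist x z • v) = dist y z := by
  obtain ⟨u, v, hu, hv, huv⟩ := Plane.exists_unit_pair (neg_one_le_comparisonCos hxy hxz)
    (comparisonCos_le_one hxy hxz)
  refine ⟨u, v, hu, hv, huv, ?_, ?_, ?_⟩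
  · rw [dist_zero_left, norm_smul, hu, mul_one, Real.norm_of_nonneg dist_nonneg]
  · rw [dist_zero_left, norm_smul, hv, mul_one, Real.norm_of_nonneg dist_nonneg]
  · rw [← sq_eq_sq₀ dist_nonneg dist_nonneg, Plane.dist_smul_smul_sq hu hv, huv,
      comparisonCos_mul hxy hxz]
    ring

/-- The three angles of the Euclidean comparison triangle sum to π. -/
theorem comparisonAngle_add_le {x y z : X} (hxy : 0 < dist x y) (hxz : 0 < dist x z) :
    comparisonAngle x y z + comparisonAngle y x z ≤ Real.pi := by
  obtain ⟨u, v, -, -, -, h₁, h₂, h₃⟩ := exists_comparison_vectors hxy hxz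
  rw [comparisonAngle_eq x y z _ _ _ h₁ h₂ h₃,
    comparisonAngle_eq y x z (dist x y • u) 0 (dist x z • v) (by rw [dist_comm, h₁, dist_comm])
      h₃ h₂]
  have hne : dist x y • u ≠ (0 : Plane) := by
    rw [← dist_pos, dist_comm, h₁]
    exact hxy
  have := EuclideanGeometry.angle_add_angle_add_angle_eq_pi (dist x z • v) hne
  rw [EuclideanGeometry.angle_comm (dist x y • u) 0]
  have h₄ := EuclideanGeometry.angle_nonneg (dist x y • u) (dist x z • v) (0 : Plane)
  linarith

end Comparison

/-! ### Geodesic segments and the CAT(0) inequality. -/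

section Geodesics

variable {X : Type*} [MetricSpace X]

theorem IsGeodesicSegment.dist_left {γ : ℝ → X} {x y : X} (h : IsGeodesicSegment γ x y) {s : ℝ}
    (hs : s ∈ Icc 0 (dist x y)) : dist x (γ s) = s := by
  rw [← h.1, h.2.2 0 ⟨le_rfl, dist_nonneg⟩ s hs, zero_sub, abs_neg, abs_of_nonneg hs.1]

theorem IsGeodesicSegment.reverse {γ : ℝ → X} {x y : X} (h : IsGeodesicSegment γ x y) :
    IsGeodesicSegment (fun t => γ (dist x y - t)) y x := by
  refine ⟨by simpa using h.2.1, by simpa [dist_comm y x] using h.1, fun s hs t ht => ?_⟩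
  rw [dist_comm y x] at hs ht
  rw [h.2.2 _ ⟨by linarith [hs.2], by linarith [hs.1]⟩ _ ⟨by linarith [ht.2], by linarith [ht.1]⟩,
    abs_sub_comm]
  congr 1
  ring

theorem Ray.dist_eq (R : Ray X) (s t : ℝ≥0) : dist (R.1 s) (R.1 t) = |(s : ℝ) - t| := by
  rw [R.2.dist_eq, NNReal.dist_eq]

theorem Ray.dist_zero (R : Ray X) (t : ℝ≥0) : dist (R.1 0) (R.1 t) = t := by
  rw [R.dist_eq]
  simp

theorem Ray.isGeodesicSegment (R : Ray X) (T : ℝ≥0) :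
    IsGeodesicSegment (fun t => R.1 t.toNNReal) (R.1 0) (R.1 T) := by
  refine ⟨by simp, by simp [R.dist_zero], fun s hs t ht => ?_⟩
  rw [R.dist_eq, Real.coe_toNNReal _ hs.1, Real.coe_toNNReal _ ht.1]

namespace IsCAT0


theorem dist_sq_le (hX : IsCAT0 X) {x y z : X} {α β : ℝ → X} (hα : IsGeodesicSegment α x y)
    (hβ : IsGeodesicSegment β x z) (hxy : 0 < dist x y) (hxz : 0 < dist x z) {s t : ℝ}
    (hs : s ∈ Icc 0 (dist x y)) (ht : t ∈ Icc 0 (dist x z)) :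
    dist (α s) (β t) ^ 2 ≤ s ^ 2 + t ^ 2 - 2 * s * t * comparisonCos x y z := by
  obtain ⟨u, v, hu, hv, huv, h₁, h₂, h₃⟩ := exists_comparison_vectors hxy hxz
  have h := hX.thin x y z α β hα hβ 0 _ _ h₁ h₂ h₃ s hs t ht (s • u) (smul_mem_segment_zero u hs)
    (t • v) (smul_mem_segment_zero v ht)
    (by rw [dist_zero_left, norm_smul, hu, mul_one, Real.norm_of_nonneg hs.1])
    (by rw [dist_zero_left, norm_smul, hv, mul_one, Real.norm_of_nonneg ht.1])
  rw [← huv, ← Plane.dist_smul_smul_sq hu hv]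
  exact pow_le_pow_left₀ dist_nonneg h 2

/-- Monotonicity of comparison angles, in cosine form: `dist_sq_le` solved for the cosine. -/
theorem comparisonCos_le (hX : IsCAT0 X) {x y z : X} {α β : ℝ → X} (hα : IsGeodesicSegment α x y)
    (hβ : IsGeodesicSegment β x z) {s t : ℝ} (hs : 0 < s) (hs' : s ≤ dist x y) (ht : 0 < t)
    (ht' : t ≤ dist x z) : comparisonCos x y z ≤ comparisonCos x (α s) (β t) := by
  have h := hX.dist_sq_le hα hβ (hs.trans_le hs') (ht.trans_le ht') ⟨hs.le, hs'⟩ ⟨ht.le, ht'⟩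
  rw [comparisonCos.eq_def x (α s), hα.dist_left ⟨hs.le, hs'⟩, hβ.dist_left ⟨ht.le, ht'⟩,
    le_div_iff₀ (by positivity)]
  linarith

theorem comparisonAngle_le (hX : IsCAT0 X) {x y z : X} {α β : ℝ → X} (hα : IsGeodesicSegment α x y)
    (hβ : IsGeodesicSegment β x z) {s t : ℝ} (hs : 0 < s) (hs' : s ≤ dist x y) (ht : 0 < t)
    (ht' : t ≤ dist x z) : comparisonAngle x (α s) (β t) ≤ comparisonAngle x y z :=
  Real.arccos_le_arccos (hX.comparisonCos_le hα hβ hs hs' ht ht')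

theorem dist_scale_le (hX : IsCAT0 X) {x y z : X} {α β : ℝ → X} (hα : IsGeodesicSegment α x y)
    (hβ : IsGeodesicSegment β x z) {k : ℝ} (hk : k ∈ Icc (0 : ℝ) 1) :
    dist (α (k * dist x y)) (β (k * dist x z)) ≤ k * dist y z := by
  have hmem (a : ℝ) (ha : 0 ≤ a) : k * a ∈ Icc 0 a :=
    ⟨mul_nonneg hk.1 ha, mul_le_of_le_one_left ha hk.2⟩
  rcases (dist_nonneg (x := x) (y := y)).eq_or_lt with hxy | hxy
  · have : x = y := dist_eq_zero.1 hxy.symm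
    subst this
    rw [dist_self, mul_zero, hα.1, hβ.dist_left (hmem _ dist_nonneg)]
  rcases (dist_nonneg (x := x) (y := z)).eq_or_lt with hxz | hxz
  · have : x = z := dist_eq_zero.1 hxz.symm
    subst this
    rw [dist_self, mul_zero, hβ.1, dist_comm, hα.dist_left (hmem _ dist_nonneg), dist_comm]
  refine le_of_sq_le_sq ?_ (mul_nonneg hk.1 dist_nonneg)
  refine (hX.dist_sq_le hα hβ hxy hxz (hmem _ dist_nonneg) (hmem _ dist_nonneg)).trans_eq ?_
  linear_combination -k ^ 2 * comparisonCos_mul hxy hxz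

/-- With `a`, `b` the two sides at `x`, the law of cosines gives `2ab(1 - cos) = dist y z ^ 2 - (a -
b) ^ 2`. The bound vanishes when `y = z`, and also when `a` and `b` tend to infinity with `dist y z`
bounded. -/
theorem dist_sq_le_of_same_time (hX : IsCAT0 X) {x y z : X} {α β : ℝ → X} (hα : IsGeodesicSegment α x y)
    (hβ : IsGeodesicSegment β x z) (hxy : 0 < dist x y) (hxz : 0 < dist x z) {t : ℝ}
    (ht : 0 ≤ t) (hty : t ≤ dist x y) (htz : t ≤ dist x z) :
    dist (α t) (β t) ^ 2 ≤ t ^ 2 * (dist y z ^ 2 / (dist x y * dist x z)) := by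
  refine (hX.dist_sq_le hα hβ hxy hxz ⟨ht, hty⟩ ⟨ht, htz⟩).trans ?_
  have h : 2 - 2 * comparisonCos x y z ≤ dist y z ^ 2 / (dist x y * dist x z) := by
    rw [le_div_iff₀ (by positivity)]
    nlinarith [comparisonCos_mul hxy hxz, sq_nonneg (dist x y - dist x z)]
  nlinarith [mul_le_mul_of_nonneg_left h (sq_nonneg t)]

theorem segment_unique (hX : IsCAT0 X) {x y : X} {α β : ℝ → X} (hα : IsGeodesicSegment α x y)
    (hβ : IsGeodesicSegment β x y) {t : ℝ} (ht : t ∈ Icc 0 (dist x y)) : α t = β t := by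
  rcases (dist_nonneg (x := x) (y := y)).eq_or_lt with hxy | hxy
  · have : t = 0 := le_antisymm (hxy ▸ ht.2) ht.1
    rw [this, hα.1, hβ.1]
  have h := hX.dist_sq_le_of_same_time hα hβ hxy hxy ht.1 ht.2 ht.2
  rw [dist_self] at h
  have h' : dist (α t) (β t) ^ 2 = 0 := le_antisymm (by simpa using h) (sq_nonneg _)
  exact dist_eq_zero.1 (pow_eq_zero_iff two_ne_zero |>.1 h')

end IsCAT0

end Geodesics

/-! ### Rays, their uniqueness and existence from every base point. -/

section Rays

variable {X : Type*} [MetricSpace X]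

theorem Ray.endpoint_eq_iff {R S : Ray X} :
    Ray.endpoint R = Ray.endpoint S ↔ ∃ C : ℝ, ∀ t, dist (R.1 t) (S.1 t) ≤ C :=
  Quotient.eq (r := raySetoid X)

/-- In a proper space, maps that are eventually isometric on pairs of times have a limit ray along
an ultrafilter. -/
theorem exists_limit_ray [ProperSpace X] {ι : Type*} (𝒰 : Ultrafilter ι) (o : X)
    (f : ι → ℝ≥0 → X) (h₀ : ∀ i, f i 0 = o)
    (h : ∀ s t : ℝ≥0, ∀ᶠ i in 𝒰, dist (f i s) (f i t) = dist s t) :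
    ∃ R : Ray X, R.1 0 = o ∧ ∀ t, Tendsto (fun i => f i t) 𝒰 (𝓝 (R.1 t)) := by
  have key (t : ℝ≥0) : ∃ x : X, Tendsto (fun i => f i t) 𝒰 (𝓝 x) := by
    have hmem : ∀ᶠ i in 𝒰, f i t ∈ Metric.closedBall o t := by
      filter_upwards [h t 0] with i hi
      rw [Metric.mem_closedBall, ← h₀ i, hi, NNReal.dist_eq]
      simp
    obtain ⟨x, -, hx⟩ := (isCompact_closedBall o (t : ℝ)).ultrafilter_le_nhds
      (𝒰.map fun i => f i t) (le_principal_iff.2 hmem)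
    exact ⟨x, hx⟩
  choose R hR using key
  refine ⟨⟨R, Isometry.of_dist_eq fun s t => ?_⟩, ?_, hR⟩
  · exact tendsto_nhds_unique ((hR s).dist (hR t))
      (tendsto_const_nhds.congr' ((h s t).mono fun i hi => hi.symm))
  · refine tendsto_nhds_unique (hR 0) ?_
    simp only [h₀]
    exact tendsto_const_nhds

theorem exists_limit_ray_of_rays [ProperSpace X] {ι : Type*} (𝒰 : Ultrafilter ι) (o : X)
    (R : ι → Ray X) (h₀ : ∀ i, (R i).1 0 = o) :
    ∃ S : Ray X, S.1 0 = o ∧ ∀ t, Tendsto (fun i => (R i).1 t) 𝒰 (𝓝 (S.1 t)) :=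
  exists_limit_ray 𝒰 o (fun i => (R i).1) h₀ fun s t => .of_forall fun i => (R i).2.dist_eq s t

theorem exists_limit_ray_of_segments [ProperSpace X] {ι : Type*} (𝒰 : Ultrafilter ι) (o : X)
    (γ : ι → ℝ → X) (z : ι → X) (hγ : ∀ i, IsGeodesicSegment (γ i) o (z i))
    (hz : Tendsto (fun i => dist o (z i)) 𝒰 atTop) :
    ∃ R : Ray X, R.1 0 = o ∧ ∀ t : ℝ≥0, Tendsto (fun i => γ i t) 𝒰 (𝓝 (R.1 t)) := by
  refine exists_limit_ray 𝒰 o (fun i t => γ i t) (fun i => (hγ i).1) fun s t => ?_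
  filter_upwards [hz.eventually_ge_atTop (s : ℝ), hz.eventually_ge_atTop (t : ℝ)] with i hs ht
  rw [(hγ i).2.2 s ⟨s.2, hs⟩ t ⟨t.2, ht⟩, NNReal.dist_eq]

namespace IsCAT0

/-- A chosen geodesic segment between two points. -/
noncomputable def geo (hX : IsCAT0 X) (x y : X) : ℝ → X := (hX.exists_geodesic x y).choose

theorem isGeodesicSegment_geo (hX : IsCAT0 X) (x y : X) : IsGeodesicSegment (hX.geo x y) x y :=
  (hX.exists_geodesic x y).choose_spec

/-- Convexity read backwards: rays from a common point separate at least linearly, so bounded errors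
disappear under rescaling. -/
theorem mul_dist_le (hX : IsCAT0 X) {R S : Ray X} (h : R.1 0 = S.1 0) (s t : ℝ≥0) {k : ℝ≥0}
    (hk : 1 ≤ k) : k * dist (R.1 s) (S.1 t) ≤ dist (R.1 (k * s)) (S.1 (k * t)) := by
  have hk0 : (0 : ℝ) < k := by exact_mod_cast zero_lt_one.trans_le hk
  have hS := S.isGeodesicSegment (k * t)
  rw [← h] at hS
  have := hX.dist_scale_le (R.isGeodesicSegment (k * s)) hS (k := (k : ℝ)⁻¹)
    ⟨by positivity, inv_le_one_of_one_le₀ (by exact_mod_cast hk)⟩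
  rw [R.dist_zero, h, S.dist_zero, NNReal.coe_mul, NNReal.coe_mul, inv_mul_cancel_left₀ hk0.ne',
    inv_mul_cancel_left₀ hk0.ne', Real.toNNReal_coe, Real.toNNReal_coe,
    inv_mul_eq_div, le_div_iff₀ hk0] at this
  linarith

theorem ray_unique (hX : IsCAT0 X) {R S : Ray X} (h : R.1 0 = S.1 0)
    (hRS : Ray.endpoint R = Ray.endpoint S) : R = S := by
  obtain ⟨C, hC⟩ := Ray.endpoint_eq_iff.1 hRS
  refine Subtype.ext (funext fun t => ?_)
  by_contra hne
  have hpos := dist_pos.2 hne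
  obtain ⟨n, hn⟩ := exists_nat_gt (C / dist (R.1 t) (S.1 t))
  rw [div_lt_iff₀ hpos] at hn
  have h₁ := hX.mul_dist_le h t t (k := (n + 1 : ℕ)) (by simp)
  have h₂ := hC ((n + 1 : ℕ) * t)
  push_cast at h₁ h₂
  linarith

/-- Convexity is applied from the far vertex `R.1 n`. It compares the segment with `R` at time `t *
n / L`, which differs from `t` by at most `|n - L| ≤ dist o (R.1 0)`; each of the two errors costs
one `dist o (R.1 0)`. -/
theorem dist_geo_ray_le (hX : IsCAT0 X) (o : X) (R : Ray X) {t n : ℝ≥0}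
    (ht : (t : ℝ) ≤ dist o (R.1 n)) (hpos : 0 < dist o (R.1 n)) :
    dist (hX.geo o (R.1 n) t) (R.1 t) ≤ 2 * dist o (R.1 0) := by
  set L := dist o (R.1 n) with hL
  have hγ := (hX.isGeodesicSegment_geo o (R.1 n)).reverse
  have hR := (R.isGeodesicSegment n).reverse
  have hk : (L - t) / L ∈ Icc (0 : ℝ) 1 :=
    ⟨div_nonneg (by linarith) hpos.le, div_le_one_of_le₀ (by linarith [t.2]) hpos.le⟩
  have h := hX.dist_scale_le hγ hR hk
  have e₁ : L - (L - t) / L * dist (R.1 n) o = t := by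
    rw [dist_comm, ← hL]
    field_simp
    ring
  have e₂ : (n : ℝ) - (L - t) / L * n = t * n / L := by
    field_simp
    ring
  have hRn : dist (R.1 n) (R.1 0) = n := by rw [dist_comm, R.dist_zero]
  simp only [hRn, R.dist_zero, ← hL, e₁, e₂] at h
  have h₁ : dist (R.1 (t * n / L).toNNReal) (R.1 t) ≤ dist o (R.1 0) := by
    rw [R.dist_eq, Real.coe_toNNReal _ (by positivity)]
    have e₃ : (t * n / L - t : ℝ) = t / L * (n - L) := by
      field_simp
    rw [e₃, abs_mul, abs_of_nonneg (by positivity)]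
    refine (mul_le_of_le_one_left (abs_nonneg _) (div_le_one_of_le₀ ht hpos.le)).trans ?_
    have a₁ := dist_triangle o (R.1 0) (R.1 n)
    have a₂ := dist_triangle_left (R.1 0) (R.1 n) o
    rw [R.dist_zero] at a₁ a₂
    exact abs_le.2 ⟨by linarith, by linarith⟩
  have h₂ := mul_le_of_le_one_left (dist_nonneg (x := o) (y := R.1 0)) hk.2
  linarith [dist_triangle (hX.geo o (R.1 n) t) (R.1 (t * n / L).toNNReal) (R.1 t)]

theorem tendsto_dist_ray (o : X) (R : Ray X) :
    Tendsto (fun n : ℝ≥0 => dist o (R.1 n)) atTop atTop := by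
  refine tendsto_atTop_mono (f := fun n : ℝ≥0 => (n : ℝ) - dist o (R.1 0)) (fun n => ?_) ?_
  · have := dist_triangle_left (R.1 0) (R.1 n) o
    rw [R.dist_zero] at this
    linarith
  · exact tendsto_atTop_add_const_right _ _ (NNReal.tendsto_coe_atTop.2 tendsto_id)

theorem exists_ray (hX : IsCAT0 X) [ProperSpace X] (o : X) (ξ : Boundary X) :
    ∃ R : Ray X, R.1 0 = o ∧ Ray.endpoint R = ξ := by
  induction ξ using Quotient.inductionOn with
  | _ S =>
  have hS : Tendsto (fun n : ℝ≥0 => dist o (S.1 n)) (Ultrafilter.of (atTop : Filter ℝ≥0)) atTop :=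
    (tendsto_dist_ray o S).mono_left (Ultrafilter.of_le _)
  obtain ⟨R, hR₀, hR⟩ := exists_limit_ray_of_segments (Ultrafilter.of (atTop : Filter ℝ≥0)) o
    (fun n => hX.geo o (S.1 n)) (fun n => S.1 n) (fun n => hX.isGeodesicSegment_geo _ _) hS
  refine ⟨R, hR₀, Ray.endpoint_eq_iff.2 ⟨2 * dist o (S.1 0), fun t => ?_⟩⟩
  refine le_of_tendsto ((hR t).dist tendsto_const_nhds) ?_
  filter_upwards [hS.eventually_ge_atTop (t : ℝ), hS.eventually_gt_atTop 0] with n h₁ h₂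
  exact hX.dist_geo_ray_le o S h₁ h₂

/-- Segments from a common point to points at bounded distance, going to infinity, have the same
limit. -/
theorem tendsto_dist_of_bounded (hX : IsCAT0 X) {ι : Type*} {l : Filter ι} {o : X} {y z : ι → X}
    {α β : ι → ℝ → X} (hα : ∀ i, IsGeodesicSegment (α i) o (y i))
    (hβ : ∀ i, IsGeodesicSegment (β i) o (z i)) {C : ℝ} (hC : ∀ i, dist (y i) (z i) ≤ C)
    (hy : Tendsto (fun i => dist o (y i)) l atTop) (hz : Tendsto (fun i => dist o (z i)) l atTop)
    (t : ℝ≥0) : Tendsto (fun i => dist (α i t) (β i t)) l (𝓝 0) := by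
  have h : Tendsto (fun i => (t : ℝ) ^ 2 * (C ^ 2 / (dist o (y i) * dist o (z i)))) l (𝓝 0) := by
    simpa using ((hy.atTop_mul_atTop₀ hz).const_div_atTop (C ^ 2)).const_mul ((t : ℝ) ^ 2)
  have h' : Tendsto (fun i => dist (α i t) (β i t) ^ 2) l (𝓝 0) := by
    refine tendsto_of_tendsto_of_tendsto_of_le_of_le' tendsto_const_nhds h
      (.of_forall fun i => sq_nonneg _) ?_
    filter_upwards [hy.eventually_ge_atTop (t : ℝ), hz.eventually_ge_atTop (t : ℝ),
      hy.eventually_gt_atTop 0, hz.eventually_gt_atTop 0] with i h₁ h₂ h₃ h₄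
    refine (hX.dist_sq_le_of_same_time (hα i) (hβ i) h₃ h₄ t.2 h₁ h₂).trans ?_
    have := pow_le_pow_left₀ dist_nonneg (hC i) 2
    exact mul_le_mul_of_nonneg_left (div_le_div_of_nonneg_right this (by positivity)) (sq_nonneg _)
  simpa [Real.sqrt_sq dist_nonneg] using h'.sqrt

/-- Comparing with the known ray `R` gives convergence along all of `atTop`, not merely along an
ultrafilter. -/
theorem tendsto_geo_ray (hX : IsCAT0 X) {o : X} {R S : Ray X} (hR : R.1 0 = o)
    (h : Ray.endpoint R = Ray.endpoint S) (t : ℝ≥0) :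
    Tendsto (fun T : ℝ≥0 => hX.geo o (S.1 T) t) atTop (𝓝 (R.1 t)) := by
  obtain ⟨C, hC⟩ := Ray.endpoint_eq_iff.1 h
  have := hX.tendsto_dist_of_bounded (l := atTop) (o := o) (y := fun T : ℝ≥0 => R.1 T)
    (z := fun T : ℝ≥0 => S.1 T) (fun T => hR ▸ R.isGeodesicSegment T)
    (fun T => hX.isGeodesicSegment_geo o (S.1 T)) hC (tendsto_dist_ray o R) (tendsto_dist_ray o S) t
  rw [tendsto_iff_dist_tendsto_zero]
  simpa [dist_comm] using this

end IsCAT0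

end Rays

/-! ### Angles at infinity and the upper bound on the Tits metric. -/

section AngleBounds

variable {X : Type*} [MetricSpace X]

/-- The angle at infinity of the two rays is at most `β`, in terms of Euclidean comparison. -/
def AngleLE (R S : Ray X) (β : ℝ) : Prop :=
  ∀ s t : ℝ≥0, dist (R.1 s) (S.1 t) ^ 2 ≤ s ^ 2 + t ^ 2 - 2 * s * t * Real.cos β

theorem comparison_sq_nonneg (s t β : ℝ) : 0 ≤ s ^ 2 + t ^ 2 - 2 * s * t * Real.cos β := by
  nlinarith [sq_nonneg (s - t * Real.cos β), sq_nonneg (t * Real.sin β), Real.sin_sq_add_cos_sq β]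

theorem AngleLE.symm {R S : Ray X} {β : ℝ} (h : AngleLE R S β) : AngleLE S R β := fun s t => by
  rw [dist_comm]
  linarith [h t s]

theorem AngleLE.refl (R : Ray X) : AngleLE R R 0 := fun s t => by
  rw [R.dist_eq, sq_abs, Real.cos_zero]
  exact le_of_eq (by ring)

theorem AngleLE.eq {R S : Ray X} (h : AngleLE R S 0) : R = S := by
  refine Subtype.ext (funext fun t => dist_eq_zero.1 (pow_eq_zero_iff two_ne_zero |>.1
    (le_antisymm ?_ (sq_nonneg _))))
  refine (h t t).trans_eq ?_
  rw [Real.cos_zero]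
  ring

/-- A point on the bisecting ray of a Euclidean triangle. -/
theorem exists_euclidean_split {r w β γ : ℝ} (hr : 0 < r) (hw : 0 < w) (hβ : 0 < β) (hγ : 0 < γ)
    (h : β + γ < Real.pi) : ∃ s : ℝ, 0 ≤ s ∧
      √(r ^ 2 + s ^ 2 - 2 * r * s * Real.cos β) + √(s ^ 2 + w ^ 2 - 2 * s * w * Real.cos γ) =
        √(r ^ 2 + w ^ 2 - 2 * r * w * Real.cos (β + γ)) := by
  have hsβ : 0 < Real.sin β := Real.sin_pos_of_pos_of_lt_pi hβ (by linarith)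
  have hsγ : 0 < Real.sin γ := Real.sin_pos_of_pos_of_lt_pi hγ (by linarith)
  have hsβγ : 0 < Real.sin (β + γ) := Real.sin_pos_of_pos_of_lt_pi (by linarith) h
  have hden : 0 < r * Real.sin β + w * Real.sin γ := by positivity
  set den := r * Real.sin β + w * Real.sin γ
  -- Equate areas: a cevian of length `s` cuts the triangle with sides `r`, `w` and angle `β + γ`
  -- into triangles with angles `β` and `γ`.
  set s := r * w * Real.sin (β + γ) / den with hs
  have hs0 : 0 < s := by positivity
  have hsden : s * den = r * w * Real.sin (β + γ) := div_mul_cancel₀ _ hden.ne'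
  let z (a b : ℝ) : ℂ := ⟨a, b⟩
  have hdist (a b c d : ℝ) : dist (z a b) (z c d) = √((a - c) ^ 2 + (b - d) ^ 2) :=
    Complex.dist_eq_re_im _ _
  have hwb : Wbtw ℝ (z (r * Real.cos β) (r * Real.sin β)) (z s 0)
      (z (w * Real.cos γ) (-(w * Real.sin γ))) := by
    refine ⟨r * Real.sin β / den, ⟨by positivity, ?_⟩, ?_⟩
    · exact div_le_one_of_le₀ (by simp only [den]; nlinarith) hden.le
    · rw [AffineMap.lineMap_apply, vsub_eq_sub, vadd_eq_add]
      apply Complex.ext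
      · simp only [z, hs, Complex.add_re, Complex.real_smul, Complex.re_ofReal_mul, Complex.sub_re]
        rw [Real.sin_add]
        field_simp
        simp only [den]
        ring
      · simp only [z, Complex.add_im, Complex.real_smul, Complex.im_ofReal_mul, Complex.sub_im]
        field_simp
        simp only [den]
        ring
  have := hwb.dist_add_dist
  rw [hdist, hdist, hdist] at this
  refine ⟨s, hs0.le, ?_⟩
  convert this using 3
  · linear_combination (-r ^ 2) * Real.sin_sq_add_cos_sq β
  · linear_combination (-w ^ 2) * Real.sin_sq_add_cos_sq γ
  · rw [Real.cos_add]
    linear_combination (-r ^ 2) * Real.sin_sq_add_cos_sq β + (-w ^ 2) * Real.sin_sq_add_cos_sq γ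

/-- The time `s` on `S` is chosen so that the Euclidean model points are collinear; the triangle
inequality through `S s` then yields exactly the third Euclidean side. -/
theorem AngleLE.trans {R S T : Ray X} {β γ : ℝ} (h₁ : AngleLE R S β) (h₂ : AngleLE S T γ)
    (h₀ : R.1 0 = S.1 0) (h₀' : S.1 0 = T.1 0) (hβ : 0 ≤ β) (hγ : 0 ≤ γ) (h : β + γ < Real.pi) :
    AngleLE R T (β + γ) := by
  rcases hβ.eq_or_lt with rfl | hβ
  · rwa [zero_add, h₁.eq]
  rcases hγ.eq_or_lt with rfl | hγ
  · rwa [add_zero, ← h₂.eq]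
  intro r w
  rcases eq_zero_or_pos r with rfl | hr
  · rw [h₀, h₀', T.dist_zero]
    simp
  rcases eq_zero_or_pos w with rfl | hw
  · rw [← h₀', ← h₀, dist_comm, R.dist_zero]
    simp
  obtain ⟨s, hs, hsum⟩ := exists_euclidean_split (r := r) (w := w) hr hw hβ hγ h
  have k₁ := Real.le_sqrt_of_sq_le (h₁ r ⟨s, hs⟩)
  have k₂ := Real.le_sqrt_of_sq_le (h₂ ⟨s, hs⟩ w)
  change _ ≤ √((r : ℝ) ^ 2 + s ^ 2 - 2 * r * s * Real.cos β) at k₁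
  change _ ≤ √(s ^ 2 + (w : ℝ) ^ 2 - 2 * s * w * Real.cos γ) at k₂
  have k := (dist_triangle _ _ _).trans (add_le_add k₁ k₂)
  rw [hsum] at k
  rw [← Real.sq_sqrt (comparison_sq_nonneg r w (β + γ))]
  exact pow_le_pow_left₀ dist_nonneg k 2

theorem AngleLE.of_tendsto {ι : Type*} {l : Filter ι} [l.NeBot] {A B : ι → Ray X} {β : ι → ℝ}
    {R S : Ray X} {α : ℝ} (hA : ∀ t, Tendsto (fun i => (A i).1 t) l (𝓝 (R.1 t)))
    (hB : ∀ t, Tendsto (fun i => (B i).1 t) l (𝓝 (S.1 t))) (hβ : Tendsto β l (𝓝 α))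
    (h : ∀ᶠ i in l, AngleLE (A i) (B i) (β i)) : AngleLE R S α := fun s t =>
  le_of_tendsto_of_tendsto (((hA s).dist (hB t)).pow 2)
    (tendsto_const_nhds.sub (((Real.continuous_cos.tendsto α).comp hβ).const_mul _))
    (h.mono fun _ hi => hi s t)

/-- Independence of the base point. -/
theorem AngleLE.congr (hX : IsCAT0 X) {R S R' S' : Ray X} {β : ℝ} (h : AngleLE R S β)
    (h₀ : R'.1 0 = S'.1 0) (hR : Ray.endpoint R' = Ray.endpoint R)
    (hS : Ray.endpoint S' = Ray.endpoint S) : AngleLE R' S' β := by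
  obtain ⟨C, hC⟩ := Ray.endpoint_eq_iff.1 hR
  obtain ⟨D, hD⟩ := Ray.endpoint_eq_iff.1 hS
  intro s t
  set e := (s ^ 2 + t ^ 2 - 2 * s * t * Real.cos β : ℝ) with he
  have he0 : 0 ≤ e := comparison_sq_nonneg _ _ _
  have key : dist (R'.1 s) (S'.1 t) ≤ √e := by
    by_contra hlt
    rw [not_le] at hlt
    -- Under scaling by `k` an excess over `√e` would grow linearly, while the asymptotic error
    -- stays at most `C + D`.
    obtain ⟨n, hn⟩ := exists_nat_gt ((C + D) / (dist (R'.1 s) (S'.1 t) - √e))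
    rw [div_lt_iff₀ (by linarith)] at hn
    let k : ℝ≥0 := (n + 1 : ℕ)
    have hk : (k : ℝ) = n + 1 := by simp [k]
    have h₁ := hX.mul_dist_le h₀ s t (k := k) (by simp [k])
    have h₂ : dist (R.1 (k * s)) (S.1 (k * t)) ≤ k * √e := by
      refine le_of_sq_le_sq ?_ (by positivity)
      refine (h (k * s) (k * t)).trans_eq ?_
      rw [mul_pow, Real.sq_sqrt he0, he]
      push_cast
      ring
    have h₃ := dist_triangle4 (R'.1 (k * s)) (R.1 (k * s)) (S.1 (k * t)) (S'.1 (k * t))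
    have h₄ := hC (k * s)
    have h₅ := hD (k * t)
    rw [dist_comm] at h₅
    rw [hk] at h₁ h₂
    nlinarith
  rw [← Real.sq_sqrt he0]
  exact pow_le_pow_left₀ dist_nonneg key 2

theorem AngleLE.comparisonAngle_le {R S : Ray X} {β : ℝ} (h : AngleLE R S β) (h₀ : R.1 0 = S.1 0)
    (hβ : 0 ≤ β) (hβ' : β ≤ Real.pi) {s t : ℝ≥0} (hs : 0 < s) (ht : 0 < t) :
    comparisonAngle (R.1 0) (R.1 s) (S.1 t) ≤ β := by
  rw [← Real.arccos_cos hβ hβ', comparisonAngle_def]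
  apply Real.arccos_le_arccos
  rw [comparisonCos, R.dist_zero, h₀, S.dist_zero, le_div_iff₀ (by positivity)]
  linarith [h s t]

theorem AngleLE.rayAngle_le {R S : Ray X} {β : ℝ} (h : AngleLE R S β) (h₀ : R.1 0 = S.1 0)
    (hβ : 0 ≤ β) (hβ' : β ≤ Real.pi) : rayAngle R S ≤ β := by
  refine limsup_le_of_le ?_ ?_
  · exact isCoboundedUnder_le_of_le _ (x := 0) fun q => Real.arccos_nonneg _
  · filter_upwards [prod_mem_prod self_mem_nhdsWithin self_mem_nhdsWithin] with q hq
    exact h.comparisonAngle_le h₀ hβ hβ' hq.1 hq.2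

/-- By `AngleLE.congr` the bound holds at every base point, hence for the supremum. -/
theorem AngleLE.angle_le (hX : IsCAT0 X) {R S : Ray X} {β : ℝ} (h : AngleLE R S β)
    (hβ : 0 ≤ β) (hβ' : β ≤ Real.pi) : angle (Ray.endpoint R) (Ray.endpoint S) ≤ β := by
  refine Real.sSup_le ?_ hβ
  rintro _ ⟨R', S', h₀, hR, hS, rfl⟩
  exact (h.congr hX h₀ hR hS).rayAngle_le h₀ hβ hβ'

theorem rayAngle_nonneg (R S : Ray X) : 0 ≤ rayAngle R S := by
  refine le_limsup_of_frequently_le (.of_forall fun q => Real.arccos_nonneg _) ?_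
  exact isBoundedUnder_of ⟨Real.pi, fun q => Real.arccos_le_pi _⟩

theorem angle_nonneg (a b : Boundary X) : 0 ≤ angle a b := by
  refine Real.sSup_nonneg ?_
  rintro _ ⟨R, S, -, -, -, rfl⟩
  exact rayAngle_nonneg R S

/-- `M` is a limit of the segments from the origin to the midpoints of `A T` and `B T`. -/
theorem exists_midpoint_ray [ProperSpace X] (hX : IsCAT0 X) {A B : Ray X} (h₀ : A.1 0 = B.1 0)
    {α : ℝ} (h : AngleLE A B α) (hα : 0 ≤ α) (hα' : α < Real.pi) :
    ∃ M : Ray X, M.1 0 = A.1 0 ∧ AngleLE A M (α / 2) ∧ AngleLE M B (α / 2) := by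
  set c := Real.cos (α / 2)
  set σ := Real.sin (α / 2) with hσdef
  have hc : 0 < c := Real.cos_pos_of_mem_Ioo ⟨by linarith, by linarith⟩
  have hσ : 0 ≤ σ := Real.sin_nonneg_of_nonneg_of_le_pi (by linarith) (by linarith)
  have hcσ : σ ^ 2 + c ^ 2 = 1 := Real.sin_sq_add_cos_sq _
  have hσ1 : σ < 1 := by nlinarith
  have hcos : Real.cos α = 1 - 2 * σ ^ 2 := by
    have := Real.cos_two_mul (α / 2)
    rw [mul_div_cancel₀ _ two_ne_zero] at this
    rw [this]
    linarith
  have hd (T : ℝ≥0) : dist (A.1 T) (B.1 T) ≤ 2 * (T * σ) := by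
    refine le_of_sq_le_sq ((h T T).trans_eq ?_) (by positivity)
    rw [hcos]
    ring
  let m (T : ℝ≥0) : X := hX.geo (A.1 T) (B.1 T) (dist (A.1 T) (B.1 T) / 2)
  have hmem (T : ℝ≥0) : dist (A.1 T) (B.1 T) / 2 ∈ Icc 0 (dist (A.1 T) (B.1 T)) :=
    ⟨by positivity, half_le_self dist_nonneg⟩
  have hmA (T : ℝ≥0) : dist (A.1 T) (m T) ≤ T * σ := by
    rw [(hX.isGeodesicSegment_geo _ _).dist_left (hmem T)]
    linarith [hd T]
  have hmB (T : ℝ≥0) : dist (B.1 T) (m T) ≤ T * σ := by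
    have hs := hX.isGeodesicSegment_geo (A.1 T) (B.1 T)
    have : dist (B.1 T) (m T) = dist (A.1 T) (B.1 T) / 2 := by
      conv_lhs => rw [← hs.2.1]
      rw [hs.2.2 _ ⟨dist_nonneg, le_rfl⟩ _ (hmem T), abs_of_nonneg (by linarith [(hmem T).2])]
      ring
    rw [this]
    linarith [hd T]
  -- The midpoints escape to infinity because `σ < 1`, that is, because `α < π`.
  have hD (T : ℝ≥0) : T * (1 - σ) ≤ dist (A.1 0) (m T) := by
    have := dist_triangle_right (A.1 0) (A.1 T) (m T)
    rw [A.dist_zero] at this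
    linarith [hmA T]
  have hDtop : Tendsto (fun T => dist (A.1 0) (m T)) atTop atTop :=
    tendsto_atTop_mono hD
      ((NNReal.tendsto_coe_atTop.2 tendsto_id).atTop_mul_const (by linarith))
  set 𝒰 := Ultrafilter.of (atTop : Filter ℝ≥0)
  have h𝒰 : (𝒰 : Filter ℝ≥0) ≤ atTop := Ultrafilter.of_le _
  obtain ⟨M, hM₀, hM⟩ := exists_limit_ray_of_segments 𝒰 (A.1 0)
    (fun T => hX.geo (A.1 0) (m T)) m (fun T => hX.isGeodesicSegment_geo _ _) (hDtop.mono_left h𝒰)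
  have key (R : Ray X) (hR₀ : R.1 0 = A.1 0) (hR : ∀ T, dist (R.1 T) (m T) ≤ T * σ) :
      AngleLE R M (α / 2) := by
    intro s t
    refine le_of_tendsto ((tendsto_const_nhds.dist (hM t)).pow 2) ?_
    filter_upwards [h𝒰 (eventually_ge_atTop s), h𝒰 (eventually_gt_atTop 0),
      (hDtop.mono_left h𝒰).eventually_ge_atTop (t : ℝ),
      (hDtop.mono_left h𝒰).eventually_gt_atTop 0] with T hs hT ht hDpos
    have hgR := R.isGeodesicSegment T
    rw [hR₀] at hgR
    have hRT : dist (A.1 0) (R.1 T) = T := by rw [← hR₀, R.dist_zero]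
    have hT' : (0 : ℝ) < T := hT
    have hle := hX.dist_sq_le hgR (hX.isGeodesicSegment_geo (A.1 0) (m T)) (hRT ▸ hT')
      hDpos (s := s) (t := t) ⟨s.2, by rw [hRT]; exact hs⟩ ⟨t.2, ht⟩
    rw [Real.toNNReal_coe] at hle
    -- With `D = dist (A.1 0) (m T)`: `T² + D² - T²σ² = T²c² + D² ≥ 2TcD`.
    have hcc : c ≤ comparisonCos (A.1 0) (R.1 T) (m T) := by
      rw [comparisonCos, hRT, le_div_iff₀ (by positivity)]
      have := pow_le_pow_left₀ dist_nonneg (hR T) 2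
      nlinarith [sq_nonneg (T * c - dist (A.1 0) (m T))]
    have hst : (0 : ℝ) ≤ 2 * s * t := by positivity
    nlinarith [mul_le_mul_of_nonneg_left hcc hst]
  exact ⟨M, hM₀, key A rfl hmA, (key B h₀.symm hmB).symm⟩

theorem exists_angle_chain [ProperSpace X] (hX : IsCAT0 X) (n : ℕ) :
    ∀ {A B : Ray X} {α : ℝ}, A.1 0 = B.1 0 → AngleLE A B α → 0 ≤ α → α < Real.pi →
    ∃ f : ℕ → Ray X, f 0 = A ∧ f (2 ^ n) = B ∧ (∀ k, (f k).1 0 = A.1 0) ∧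
      ∀ k < 2 ^ n, AngleLE (f k) (f (k + 1)) (α / 2 ^ n) := by
  induction n with
  | zero =>
    intro A B α h₀ h _ _
    refine ⟨fun k => if k = 0 then A else B, by simp, by simp, fun k => ?_, fun k hk => ?_⟩
    · beta_reduce
      split_ifs <;> simp [h₀]
    · have : k = 0 := by simpa using hk
      subst this
      simpa using h
  | succ n ih =>
    intro A B α h₀ h hα hα'
    obtain ⟨M, hM₀, h₁, h₂⟩ := exists_midpoint_ray hX h₀ h hα hα'
    obtain ⟨f, f₀, f₁, f₂, f₃⟩ := ih hM₀.symm h₁ (by linarith) (by linarith)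
    obtain ⟨g, g₀, g₁, g₂, g₃⟩ := ih (hM₀.trans h₀) h₂ (by linarith) (by linarith)
    have hdiv : α / 2 ^ (n + 1) = α / 2 / 2 ^ n := by rw [div_div, pow_succ']
    refine ⟨fun k => if k ≤ 2 ^ n then f k else g (k - 2 ^ n), by simp [f₀], ?_, fun k => ?_,
      fun k hk => ?_⟩
    · have : ¬ 2 ^ (n + 1) ≤ 2 ^ n := by rw [pow_succ]; have := Nat.two_pow_pos n; omega
      simp only [this, if_false]
      rw [← g₁]
      congr 1
      rw [pow_succ]
      omega
    · beta_reduce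
      split_ifs
      · exact f₂ k
      · rw [g₂, hM₀]
    · rw [hdiv]
      rcases lt_trichotomy k (2 ^ n) with hlt | rfl | hlt
      · simp only [hlt.le, if_true, Nat.succ_le_of_lt hlt]
        exact f₃ k hlt
      · simp only [le_refl, if_true, Nat.not_succ_le_self, if_false, Nat.add_sub_cancel_left]
        rw [f₁, ← g₀]
        exact g₃ 0 (Nat.two_pow_pos n)
      · beta_reduce
        rw [if_neg (by omega), if_neg (by omega), Nat.sub_add_comm hlt.le]
        exact g₃ _ (by rw [pow_succ] at hk; omega)

theorem angle_chain_le {f : ℕ → Ray X} {o : X} (h₀ : ∀ k, (f k).1 0 = o) {N : ℕ} {δ : ℝ}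
    (hδ : 0 ≤ δ) (hN : N * δ < Real.pi) (h : ∀ k < N, AngleLE (f k) (f (k + 1)) δ) {i : ℕ} (j : ℕ)
    (hj : i + j ≤ N) : AngleLE (f i) (f (i + j)) (j * δ) := by
  induction j with
  | zero => simpa using AngleLE.refl (f i)
  | succ j ih =>
    have h₁ := ih (by omega)
    have hle : ((j : ℝ) + 1) ≤ N := by exact_mod_cast (by omega : j + 1 ≤ N)
    have := h₁.trans (h (i + j) (by omega)) (by simp [h₀]) (by simp [h₀]) (by positivity) hδ
      (by nlinarith)
    rw [← add_assoc]
    convert this using 1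
    push_cast
    ring

/-- A path at infinity realising the angle. -/
theorem exists_angle_path [ProperSpace X] (hX : IsCAT0 X) {A B : Ray X} (h₀ : A.1 0 = B.1 0)
    {α : ℝ} (h : AngleLE A B α) (hα : 0 ≤ α) (hα' : α < Real.pi) :
    ∃ c : unitInterval → Ray X, c 0 = A ∧ c 1 = B ∧
      ∀ s t : unitInterval, s ≤ t → AngleLE (c s) (c t) ((t - s) * α) := by
  choose f f₀ f₁ f₂ f₃ using fun n => exists_angle_chain hX n h₀ h hα hα'
  set 𝒰 := Ultrafilter.of (atTop : Filter ℕ)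
  have h𝒰 : (𝒰 : Filter ℕ) ≤ atTop := Ultrafilter.of_le _
  -- Chains of different levels are chosen independently, so the path is an ultrafilter limit over
  -- `n` of the ray with dyadic index closest to `t` from below.
  let u (t : unitInterval) (n : ℕ) : ℕ := ⌊(t : ℝ) * (2 : ℝ) ^ n⌋₊
  choose c hc₀ hc using fun t : unitInterval => exists_limit_ray_of_rays 𝒰 (A.1 0)
    (fun n => f n (u t n)) (fun n => f₂ n _)
  have hu (t : unitInterval) : Tendsto (fun n => (u t n : ℝ) / 2 ^ n) atTop (𝓝 t) :=
    (tendsto_nat_floor_mul_div_atTop t.2.1).comp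
      (tendsto_pow_atTop_atTop_of_one_lt one_lt_two)
  have hule (t : unitInterval) (n : ℕ) : u t n ≤ 2 ^ n := by
    refine Nat.floor_le_of_le ?_
    push_cast
    exact mul_le_of_le_one_left (by positivity) t.2.2
  have hend {t : unitInterval} {R : Ray X} (ht : ∀ n, f n (u t n) = R) : c t = R := by
    refine Subtype.ext (funext fun r => tendsto_nhds_unique (hc t r) ?_)
    simp only [ht]
    exact tendsto_const_nhds
  refine ⟨c, hend fun n => ?_, hend fun n => ?_, fun s t hst => ?_⟩
  · simp [u, f₀]
  · have : u 1 n = 2 ^ n := by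
      simp only [u, Icc.coe_one, one_mul]
      exact_mod_cast Nat.floor_natCast (R := ℝ) (2 ^ n)
    rw [this, f₁]
  · refine AngleLE.of_tendsto (hc s) (hc t) (β := fun n => ((u t n : ℝ) / 2 ^ n - u s n / 2 ^ n) * α)
      ((((hu t).sub (hu s)).mul_const α).mono_left h𝒰) (.of_forall fun n => ?_)
    have hmono : u s n ≤ u t n :=
      Nat.floor_mono (mul_le_mul_of_nonneg_right hst (by positivity))
    obtain ⟨j, hj⟩ := Nat.exists_eq_add_of_le hmono
    have := angle_chain_le (f₂ n) (N := 2 ^ n) (δ := α / 2 ^ n) (by positivity)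
      (by push_cast; rwa [mul_div_cancel₀ _ (by positivity)]) (f₃ n) (i := u s n) j
      (hj ▸ hule t n)
    rw [hj]
    convert this using 1
    push_cast
    ring

/-- Along the path of `exists_angle_path` the angles are bounded by increments of the parameter
times `α`, so every length sum telescopes to at most `α`. -/
theorem AngleLE.titsDist_le [ProperSpace X] (hX : IsCAT0 X) {A B : Ray X} (h₀ : A.1 0 = B.1 0)
    {α : ℝ} (h : AngleLE A B α) (hα : 0 ≤ α) (hα' : α < Real.pi) :
    titsDist (Ray.endpoint A) (Ray.endpoint B) ≤ ENNReal.ofReal α := by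
  obtain ⟨c, c₀, c₁, hc⟩ := exists_angle_path hX h₀ h hα hα'
  have hle {s t : unitInterval} (hst : s ≤ t) :
      angle (Ray.endpoint (c s)) (Ray.endpoint (c t)) ≤ (t - s) * α ∧
      angle (Ray.endpoint (c t)) (Ray.endpoint (c s)) ≤ (t - s) * α := by
    have h₁ : (0 : ℝ) ≤ (t - s) * α := mul_nonneg (sub_nonneg.2 hst) hα
    have h₂ : (t - s : ℝ) * α ≤ Real.pi :=
      (mul_le_of_le_one_left hα (by linarith [t.2.2, s.2.1])).trans hα'.le
    exact ⟨(hc s t hst).angle_le hX h₁ h₂, (hc s t hst).symm.angle_le hX h₁ h₂⟩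
  refine iInf₂_le_of_le (fun t => Ray.endpoint (c t)) (fun t => ?_)
    (iInf₂_le_of_le (congrArg _ c₀) (congrArg _ c₁) ?_)
  · refine squeeze_zero (g := fun s : unitInterval => |(s : ℝ) - t| * α)
      (fun s => angle_nonneg _ _) (fun s => ?_) ?_
    · rcases le_total t s with hts | hts
      · rw [abs_of_nonneg (sub_nonneg.2 (Subtype.coe_le_coe.2 hts))]
        exact (hle hts).1
      · rw [abs_sub_comm, abs_of_nonneg (sub_nonneg.2 (Subtype.coe_le_coe.2 hts))]
        exact (hle hts).2
    · have : Continuous fun s : unitInterval => |(s : ℝ) - t| * α := by fun_prop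
      simpa using this.tendsto t
  · refine iSup_le fun m => iSup₂_le fun u hu => ?_
    have hterm (i : ℕ) : angle (Ray.endpoint (c (u i))) (Ray.endpoint (c (u (i + 1)))) ≤
        ((u (i + 1) : ℝ) - u i) * α := (hle (hu i.le_succ)).1
    rw [← ENNReal.ofReal_sum_of_nonneg fun i _ => angle_nonneg _ _]
    refine ENNReal.ofReal_le_ofReal ((Finset.sum_le_sum fun i _ => hterm i).trans ?_)
    rw [← Finset.sum_mul, Finset.sum_range_sub (fun i => (u i : ℝ))]
    exact mul_le_of_le_one_left hα (by linarith [(u m).2.2, (u 0).2.1])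

end AngleBounds

/-! ### Cone topology in terms of rays, and sequences going to infinity. -/

section Convergence

variable {X : Type*} [MetricSpace X]

theorem tendsto_comparisonAngle {ι : Type*} {l : Filter ι} {o : X} {y z : ι → X} {y' z' : X}
    (hy : Tendsto y l (𝓝 y')) (hz : Tendsto z l (𝓝 z')) (hy' : 0 < dist o y')
    (hz' : 0 < dist o z') :
    Tendsto (fun i => comparisonAngle o (y i) (z i)) l (𝓝 (comparisonAngle o y' z')) := by
  have h₁ : Tendsto (fun i => dist o (y i)) l (𝓝 (dist o y')) := tendsto_const_nhds.dist hy
  have h₂ : Tendsto (fun i => dist o (z i)) l (𝓝 (dist o z')) := tendsto_const_nhds.dist hz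
  exact (Real.continuous_arccos.tendsto _).comp
    ((((h₁.pow 2).add (h₂.pow 2)).sub ((hy.dist hz).pow 2)).div ((h₁.const_mul 2).mul h₂)
      (by positivity))

theorem comparisonAngle_smul {G : Type*} [Group G] [MulAction G X] [IsIsometricSMul G X] (g : G)
    (x y z : X) : comparisonAngle (g • x) (g • y) (g • z) = comparisonAngle x y z := by
  simp only [comparisonAngle, dist_smul]

/-- The angle at infinity of two rays: the least upper bound of the comparison angles. -/
theorem exists_least_angleLE {R S : Ray X} (h₀ : R.1 0 = S.1 0) :
    ∃ a, 0 ≤ a ∧ AngleLE R S a ∧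
      ∀ b, (∀ s t : ℝ≥0, 0 < s → 0 < t → comparisonAngle (R.1 0) (R.1 s) (S.1 t) ≤ b) → a ≤ b := by
  set A := {α | ∃ s t : ℝ≥0, 0 < s ∧ 0 < t ∧ α = comparisonAngle (R.1 0) (R.1 s) (S.1 t)}
  have hne : A.Nonempty := ⟨_, 1, 1, one_pos, one_pos, rfl⟩
  have hbdd : BddAbove A := ⟨Real.pi, by rintro _ ⟨s, t, -, -, rfl⟩; exact Real.arccos_le_pi _⟩
  refine ⟨sSup A, Real.sSup_nonneg ?_, fun s t => ?_, fun b hb => csSup_le hne ?_⟩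
  · rintro _ ⟨s, t, -, -, rfl⟩
    exact Real.arccos_nonneg _
  · rcases eq_zero_or_pos s with rfl | hs
    · rw [h₀, S.dist_zero]
      simp
    rcases eq_zero_or_pos t with rfl | ht
    · rw [← h₀, dist_comm, R.dist_zero]
      simp
    have hRs : dist (R.1 0) (R.1 s) = s := R.dist_zero s
    have hSt : dist (R.1 0) (S.1 t) = t := by rw [h₀, S.dist_zero]
    have hs' : 0 < dist (R.1 0) (R.1 s) := by rw [hRs]; exact hs
    have ht' : 0 < dist (R.1 0) (S.1 t) := by rw [hSt]; exact ht
    have hle := Real.cos_le_cos_of_nonneg_of_le_pi (Real.arccos_nonneg _)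
      (csSup_le hne (by rintro _ ⟨s, t, -, -, rfl⟩; exact Real.arccos_le_pi _))
      (le_csSup hbdd ⟨s, t, hs, ht, rfl⟩)
    replace hle := hle.trans_eq (cos_comparisonAngle hs' ht')
    have hmul := comparisonCos_mul hs' ht'
    rw [hRs, hSt] at hmul
    have hst : (0 : ℝ) ≤ 2 * s * t := by positivity
    nlinarith [mul_le_mul_of_nonneg_left hle hst]
  · rintro _ ⟨s, t, hs, ht, rfl⟩
    exact hb s t hs ht

theorem coneNhd_bd {o : X} {R S : Ray X} {r : ℝ≥0} {ε : ℝ} (hX : IsCAT0 X) (hS : S.1 0 = o) :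
    Bordification.bd (Ray.endpoint S) ∈ coneNhd o R r ε ↔ dist (R.1 r) (S.1 r) < ε := by
  refine ⟨?_, fun h => ⟨S, hS, rfl, h⟩⟩
  rintro ⟨S', h₀, h, hd⟩
  rwa [← hX.ray_unique (h₀.trans hS.symm) h]

theorem isOpen_coneNhd {o : X} {R : Ray X} {r : ℝ≥0} {ε : ℝ} (hR : R.1 0 = o) (hr : 0 < r)
    (hε : 0 < ε) : IsOpen[coneTopology o] (coneNhd o R r ε) :=
  TopologicalSpace.isOpen_generateFrom_of_mem (.inr ⟨R, r, ε, hR, hr, hε, rfl⟩)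

theorem eventually_mem_coneNhd {ι : Type*} {l : Filter ι} {o : X} {R : Ray X}
    (hR : R.1 0 = o) {z : ι → Bordification X}
    (h : Tendsto z l (@nhds _ (coneTopology o) (Bordification.bd (Ray.endpoint R)))) {r : ℝ≥0}
    {ε : ℝ} (hr : 0 < r) (hε : 0 < ε) : ∀ᶠ i in l, z i ∈ coneNhd o R r ε := by
  let _ := coneTopology o
  have hmem : Bordification.bd (Ray.endpoint R) ∈ coneNhd o R r ε :=
    ⟨R, hR, rfl, by rwa [dist_self]⟩
  exact h ((isOpen_coneNhd hR hr hε).mem_nhds hmem)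

theorem tendsto_visual_iff {ι : Type*} {l : Filter ι} {o : X} {ξ : ι → Boundary X}
    {η : Boundary X} : Tendsto ξ l (@nhds _ (visualTopology o) η) ↔
      Tendsto (fun i => Bordification.bd (ξ i)) l (@nhds _ (coneTopology o) (Bordification.bd η)) := by
  rw [@nhds_induced _ _ (coneTopology o), tendsto_comap_iff]
  rfl

/-- Open balls of `X` contain no boundary points, so only the sets `coneNhd` matter, and by
uniqueness of rays these test a single time. -/
theorem tendsto_visual_iff_rays (hX : IsCAT0 X) {ι : Type*} {l : Filter ι} {o : X} {S : ι → Ray X}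
    {R : Ray X} (hR : R.1 0 = o) (hS : ∀ i, (S i).1 0 = o) :
    Tendsto (fun i => Ray.endpoint (S i)) l (@nhds _ (visualTopology o) (Ray.endpoint R)) ↔
      ∀ t, Tendsto (fun i => (S i).1 t) l (𝓝 (R.1 t)) := by
  rw [tendsto_visual_iff]
  refine ⟨fun h t => ?_, fun h => ?_⟩
  · rcases eq_zero_or_pos t with rfl | ht
    · simp only [hS, hR]
      exact tendsto_const_nhds
    refine Metric.tendsto_nhds.2 fun ε hε => ?_
    filter_upwards [eventually_mem_coneNhd hR h ht hε] with i hi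
    rw [dist_comm]
    exact (coneNhd_bd hX (hS i)).1 hi
  · refine TopologicalSpace.tendsto_nhds_generateFrom_iff.2 ?_
    rintro _ (⟨x, ε, -, rfl⟩ | ⟨Q, r, ε, -, -, -, rfl⟩) hmem
    · obtain ⟨y, -, hy⟩ := hmem
      cases hy
    · filter_upwards [((tendsto_const_nhds (x := Q.1 r)).dist (h r)).eventually_lt_const
        ((coneNhd_bd hX hR).1 hmem)] with i hi
      exact (coneNhd_bd hX (hS i)).2 hi

/-- The points `z i` go to infinity in the direction of the ray `R`. -/
def TendstoRay (hX : IsCAT0 X) (o : X) (z : ℕ → X) (R : Ray X) : Prop :=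
  Tendsto (fun i => dist o (z i)) atTop atTop ∧
    ∀ t : ℝ≥0, Tendsto (fun i => hX.geo o (z i) t) atTop (𝓝 (R.1 t))

theorem TendstoRay.of_cone (hX : IsCAT0 X) {o : X} {z : ℕ → X} {R : Ray X} (hR : R.1 0 = o)
    (h : Tendsto (fun i => Bordification.pt (z i)) atTop
      (@nhds _ (coneTopology o) (Bordification.bd (Ray.endpoint R)))) : TendstoRay hX o z R := by
  refine ⟨tendsto_atTop.2 fun b => ?_, fun t => ?_⟩
  · filter_upwards [eventually_mem_coneNhd hR h (r := b.toNNReal + 1) (by positivity) one_pos]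
      with i hi
    have := hi.1
    push_cast at this
    linarith [Real.le_coe_toNNReal b]
  · rcases eq_zero_or_pos t with rfl | ht
    · simp only [hR, NNReal.coe_zero, (hX.isGeodesicSegment_geo _ _).1]
      exact tendsto_const_nhds
    refine Metric.tendsto_nhds.2 fun ε hε => ?_
    filter_upwards [eventually_mem_coneNhd hR h ht hε] with i hi
    obtain ⟨hlt, S, hS, hd⟩ := hi
    have := hX.segment_unique (hX.isGeodesicSegment_geo o (z i)) hS (t := t) ⟨t.2, hlt.le⟩
    rwa [dist_comm, this]

theorem TendstoRay.of_bounded (hX : IsCAT0 X) {o : X} {y z : ℕ → X} {R : Ray X}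
    (h : TendstoRay hX o y R) {C : ℝ} (hC : ∀ i, dist (y i) (z i) ≤ C) : TendstoRay hX o z R := by
  have hz : Tendsto (fun i => dist o (z i)) atTop atTop := by
    refine tendsto_atTop_mono (fun i => ?_) (tendsto_atTop_add_const_right _ (-C) h.1)
    linarith [hC i, dist_triangle_right o (y i) (z i)]
  refine ⟨hz, fun t => ?_⟩
  exact ((tendsto_iff_of_dist (hX.tendsto_dist_of_bounded
    (fun i => hX.isGeodesicSegment_geo o (y i)) (fun i => hX.isGeodesicSegment_geo o (z i)) hC
    h.1 hz t)).1 (h.2 t))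

theorem tendsto_dist_smul_of_injective [ProperSpace X] {G : Type*} [Group G]
    [MulAction G X] (hG : IsProperAction X G) (o : X) {g : ℕ → G} (hg : Function.Injective g) : Tendsto (fun i => dist o (g i • o)) atTop atTop := by
  refine tendsto_atTop.2 fun b => ?_
  -- The absolute value keeps `o` inside the ball even for negative `b`.
  have hfin := (hG (Metric.closedBall o |b|) (isCompact_closedBall _ _)).preimage hg.injOn
  rw [← Nat.cofinite_eq_atTop]
  filter_upwards [hfin.compl_mem_cofinite] with i hi
  by_contra hlt
  refine hi ⟨g i • o, ⟨o, Metric.mem_closedBall_self (abs_nonneg b), rfl⟩, ?_⟩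
  rw [Metric.mem_closedBall, dist_comm]
  exact (not_le.1 hlt).le.trans (le_abs_self b)

/-! ### Dynamics of the action at infinity. -/

variable {G : Type*} [Group G] [MulAction G X] [IsIsometricSMul G X]

theorem comparisonAngle_add_comparisonAngle_le (hX : IsCAT0 X) {o : X} (g : G) {R E : Ray X}
    (hR : R.1 0 = o) (hE : E.1 0 = o) (hRE : Ray.endpoint E = g • Ray.endpoint R) {s t s' t' : ℝ≥0}
    (hs : 0 < s) (ht : 0 < t) (hs' : 0 < s') (ht' : 0 < t') (hsd : s ≤ dist o (g⁻¹ • o))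
    (hsd' : s' ≤ dist o (g • o)) :
    comparisonAngle o (hX.geo o (g⁻¹ • o) s) (R.1 t) +
      comparisonAngle o (hX.geo o (g • o) s') (E.1 t') ≤ Real.pi := by
  let S := Ray.translate g R
  have hlim := hX.tendsto_geo_ray hE (S := S) hRE t'
  have hd' : dist o (hX.geo o (g • o) s') = s' :=
    (hX.isGeodesicSegment_geo _ _).dist_left ⟨s'.2, hsd'⟩
  have hE' : dist o (E.1 t') = t' := by rw [← hE, E.dist_zero]
  refine le_of_tendsto (tendsto_const_nhds.add (tendsto_comparisonAngle tendsto_const_nhds hlim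
    (by rw [hd']; exact hs') (by rw [hE']; exact ht'))) ?_
  filter_upwards [eventually_ge_atTop t, (IsCAT0.tendsto_dist_ray o S).eventually_ge_atTop (t' : ℝ)]
    with T hT hT'
  have hRT : dist o (R.1 T) = T := by rw [← hR, R.dist_zero]
  have hgR := R.isGeodesicSegment T
  rw [hR] at hgR
  have h₁ := hX.comparisonAngle_le (hX.isGeodesicSegment_geo o (g⁻¹ • o)) hgR
    (s := s) (t := t) hs hsd ht (by rw [hRT]; exact hT)
  have h₂ := hX.comparisonAngle_le (hX.isGeodesicSegment_geo o (g • o))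
    (hX.isGeodesicSegment_geo o (S.1 T)) (s := s') (t := t') hs' hsd' ht' hT'
  -- Translation by `g` moves the angle at `g⁻¹ • o` to the base point.
  have h₃ : comparisonAngle o (g • o) (S.1 T) = comparisonAngle (g⁻¹ • o) o (R.1 T) := by
    conv_rhs => rw [← comparisonAngle_smul g, smul_inv_smul]
    rfl
  rw [Real.toNNReal_coe] at h₁
  have h₄ := comparisonAngle_add_le (x := o) (y := g⁻¹ • o) (z := R.1 T)
    ((NNReal.coe_pos.2 hs).trans_le hsd) (by rw [hRT]; exact ht.trans_le hT)
  rw [h₃] at h₂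
  linarith

theorem piConverges_of_tendstoRay [ProperSpace X] (hX : IsCAT0 X) {o : X} {g : ℕ → G} {N P : Ray X}
    (hN₀ : N.1 0 = o) (hP₀ : P.1 0 = o) (hP : TendstoRay hX o (fun i => g i • o) P)
    (hN : TendstoRay hX o (fun i => (g i)⁻¹ • o) N) :
    PiConverges o g (Ray.endpoint N) (Ray.endpoint P) := by
  intro θ hθ K hK hKn U hU hUp
  by_contra hcon
  obtain ⟨𝒰, h𝒰, hbad⟩ : ∃ 𝒰 : Ultrafilter ℕ, (𝒰 : Filter ℕ) ≤ atTop ∧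
      ∀ᶠ i in 𝒰, ∃ ξ ∈ K, g i • ξ ∉ U := by
    have : (atTop ⊓ 𝓟 {i | ∃ ξ ∈ K, g i • ξ ∉ U}).NeBot := by
      refine frequently_mem_iff_neBot.1 ((not_eventually.1 hcon).mono fun i hi => ?_)
      obtain ⟨_, ⟨ξ, hξ, rfl⟩, hξU⟩ := not_subset.1 hi
      exact ⟨ξ, hξ, hξU⟩
    exact ⟨Ultrafilter.of _, (Ultrafilter.of_le _).trans inf_le_left,
      le_principal_iff.1 ((Ultrafilter.of_le _).trans inf_le_right)⟩
  have hex (i : ℕ) : ∃ R : Ray X, R.1 0 = o ∧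
      ((∃ ξ ∈ K, g i • ξ ∉ U) → Ray.endpoint R ∈ K ∧ g i • Ray.endpoint R ∉ U) := by
    by_cases h : ∃ ξ ∈ K, g i • ξ ∉ U
    · obtain ⟨ξ, hξ⟩ := h
      obtain ⟨S, hS₀, rfl⟩ := hX.exists_ray o ξ
      exact ⟨S, hS₀, fun _ => hξ⟩
    -- A default ray for indices without a bad point; the ultrafilter ignores them.
    · exact ⟨N, hN₀, fun h' => absurd h' h⟩
  choose R hR₀ hR using hex
  have hRU : ∀ᶠ i in 𝒰, Ray.endpoint (R i) ∈ K ∧ g i • Ray.endpoint (R i) ∉ U :=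
    hbad.mono fun i hi => hR i hi
  choose E hE₀ hE using fun i => hX.exists_ray o (g i • Ray.endpoint (R i))
  obtain ⟨ξ, hξK, hξ⟩ := (@isCompact_iff_ultrafilter_le_nhds _ (visualTopology o) K).1 hK
    (𝒰.map fun i => Ray.endpoint (R i)) (le_principal_iff.2 (hRU.mono fun i hi => hi.1))
  obtain ⟨Q, hQ₀, rfl⟩ := hX.exists_ray o ξ
  have hRQ := (tendsto_visual_iff_rays hX hQ₀ hR₀).1 hξ
  obtain ⟨F, hF₀, hEF⟩ := exists_limit_ray_of_rays 𝒰 o E hE₀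
  have hFU : Ray.endpoint F ∉ U := by
    intro hmem
    let _ := visualTopology o
    have := (tendsto_visual_iff_rays hX hF₀ hE₀).2 hEF (hU.mem_nhds hmem)
    obtain ⟨i, hi, hi'⟩ := ((show ∀ᶠ i in 𝒰, Ray.endpoint (E i) ∈ U from this).and hRU).exists
    rw [hE] at hi
    exact hi'.2 hi
  have hsum {s t s' t' : ℝ≥0} (hs : 0 < s) (ht : 0 < t) (hs' : 0 < s') (ht' : 0 < t') :
      comparisonAngle o (N.1 s) (Q.1 t) + comparisonAngle o (P.1 s') (F.1 t') ≤ Real.pi := by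
    have hpos {S : Ray X} (hS : S.1 0 = o) {r : ℝ≥0} (hr : 0 < r) : 0 < dist o (S.1 r) := by
      rw [← hS, S.dist_zero]
      exact hr
    refine le_of_tendsto ((tendsto_comparisonAngle ((hN.2 s).mono_left h𝒰) (hRQ t) (hpos hN₀ hs)
      (hpos hQ₀ ht)).add (tendsto_comparisonAngle ((hP.2 s').mono_left h𝒰) (hEF t') (hpos hP₀ hs')
      (hpos hF₀ ht'))) ?_
    filter_upwards [h𝒰 (hN.1.eventually_ge_atTop (s : ℝ)), h𝒰 (hP.1.eventually_ge_atTop (s' : ℝ))]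
      with i h₁ h₂
    exact comparisonAngle_add_comparisonAngle_le hX (g i) (hR₀ i) (hE₀ i) (hE i) hs ht hs' ht' h₁ h₂
  obtain ⟨a, ha₀, ha, hale⟩ := exists_least_angleLE (hN₀.trans hQ₀.symm)
  obtain ⟨b, hb₀, hb, hble⟩ := exists_least_angleLE (hP₀.trans hF₀.symm)
  have hab : b ≤ Real.pi - a := hble _ fun s' t' hs' ht' => by
    rw [le_sub_comm]
    refine hale _ fun s t hs ht => ?_
    rw [hN₀, hP₀]
    linarith [hsum hs ht hs' ht']
  have hpi := Real.pi_pos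
  have hQθ : Ray.endpoint Q ∉ closedTitsBall (Ray.endpoint N) θ := disjoint_left.1 hKn hξK
  have hFθ : Ray.endpoint F ∉ closedTitsBall (Ray.endpoint P) (Real.pi - θ) := fun h => hFU (hUp h)
  have hb' : b < Real.pi → Real.pi - θ < b := fun h => by
    by_contra hle
    exact hFθ ((hb.titsDist_le hX (hP₀.trans hF₀.symm) hb₀ h).trans
      (ENNReal.ofReal_le_ofReal (not_lt.1 hle)))
  -- If `a < π` then `θ < a`, so `b < π` and `π - θ < b`, against `a + b ≤ π`. If `a ≥ π` then `b ≤
  -- 0`, and `π - θ < b` contradicts `θ ≤ π`.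
  rcases lt_or_ge a Real.pi with h | h
  · have haθ : θ < a := by
      by_contra hle
      exact hQθ ((ha.titsDist_le hX (hN₀.trans hQ₀.symm) ha₀ h).trans
        (ENNReal.ofReal_le_ofReal (not_lt.1 hle)))
    linarith [hb' (by linarith [hθ.1]), hθ.1]
  · linarith [hb' (by linarith), hθ.2]

/-- Sequential compactness of the visual compactification, at infinity. -/
theorem exists_subseq_tendstoRay [ProperSpace X] (hX : IsCAT0 X) {o : X} {z : ℕ → X}
    (hz : Tendsto (fun i => dist o (z i)) atTop atTop) :
    ∃ φ : ℕ → ℕ, StrictMono φ ∧ ∃ R : Ray X, R.1 0 = o ∧ TendstoRay hX o (z ∘ φ) R := by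
  have hgeo (i : ℕ) := hX.isGeodesicSegment_geo o (z i)
  -- Truncated integer times place each segment in a countable product of compact balls, which is
  -- sequentially compact.
  let x (i k : ℕ) : X := hX.geo o (z i) (min k (dist o (z i)))
  have hx (i : ℕ) : x i ∈ Set.univ.pi fun k : ℕ => Metric.closedBall o (k : ℝ) := by
    intro k _
    rw [Metric.mem_closedBall, dist_comm,
      (hgeo i).dist_left ⟨le_min k.cast_nonneg dist_nonneg, min_le_right _ _⟩]
    exact min_le_left _ _
  obtain ⟨a, -, φ, hφ, ha⟩ :=
    (isCompact_univ_pi fun k : ℕ => isCompact_closedBall o (k : ℝ)).tendsto_subseq hx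
  have hzφ := hz.comp hφ.tendsto_atTop
  -- The ultrafilter only identifies the integer-time limits as points of a ray; convergence itself
  -- holds along the whole subsequence.
  obtain ⟨R, hR₀, hR⟩ := exists_limit_ray_of_segments (Ultrafilter.of atTop) o
    (fun i => hX.geo o (z (φ i))) (z ∘ φ) (fun i => hgeo (φ i)) (hzφ.mono_left (Ultrafilter.of_le _))
  have hnat (k : ℕ) : Tendsto (fun i => hX.geo o (z (φ i)) k) atTop (𝓝 (R.1 k)) := by
    have h₁ : Tendsto (fun i => hX.geo o (z (φ i)) k) atTop (𝓝 (a k)) := by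
      refine (tendsto_pi_nhds.1 ha k).congr' ?_
      filter_upwards [hzφ.eventually_ge_atTop (k : ℝ)] with i hi
      simp only [Function.comp_apply, x]
      exact congrArg _ (min_eq_left hi)
    have h₂ := tendsto_nhds_unique (hR k) (h₁.mono_left (Ultrafilter.of_le _))
    rwa [h₂]
  refine ⟨φ, hφ, R, hR₀, hzφ, fun t => ?_⟩
  obtain ⟨k, hk⟩ := exists_nat_gt t
  have hk0 : (0 : ℝ) < k := (NNReal.coe_nonneg t).trans_lt (by exact_mod_cast hk)
  rw [tendsto_iff_dist_tendsto_zero]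
  refine squeeze_zero' (.of_forall fun _ => dist_nonneg) ?_
    (tendsto_iff_dist_tendsto_zero.1 (hnat k))
  filter_upwards [hzφ.eventually_ge_atTop (k : ℝ)] with i hi
  have hk' : ((k : ℝ≥0) : ℝ) = k := by simp
  -- Real times `t < k` follow from time `k` by convexity from `o`.
  have hsub : IsGeodesicSegment (hX.geo o (z (φ i))) o (hX.geo o (z (φ i)) k) := by
    have hd := (hgeo (φ i)).dist_left ⟨hk0.le, hi⟩
    refine ⟨(hgeo _).1, by rw [hd], fun s hs t ht => ?_⟩
    rw [hd] at hs ht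
    exact (hgeo _).2.2 s ⟨hs.1, hs.2.trans hi⟩ t ⟨ht.1, ht.2.trans hi⟩
  have hRk := R.isGeodesicSegment k
  have hdR := R.dist_zero k
  rw [hR₀] at hRk hdR
  have hmem : (t / k : ℝ) ∈ Icc (0 : ℝ) 1 :=
    ⟨by positivity, div_le_one_of_le₀ (by exact_mod_cast hk.le) hk0.le⟩
  have h := hX.dist_scale_le hsub hRk hmem
  rw [(hgeo (φ i)).dist_left ⟨hk0.le, hi⟩, hdR, hk', div_mul_cancel₀ _ hk0.ne',
    Real.toNNReal_coe] at h
  exact h.trans (mul_le_of_le_one_left dist_nonneg hmem.2)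

end Convergence

end CATZero

open CATZero in
theorem mainTheorem4 {X : Type*} [MetricSpace X] [ProperSpace X] (hX : CATZero.IsCAT0 X)
    {G : Type*} [Group G] [MulAction G X] [IsIsometricSMul G X]
    (hG : CATZero.IsProperAction X G) (o : X) :
    (∀ (x : X) (g : ℕ → G) (n p : CATZero.Boundary X),
      Tendsto (fun i => CATZero.Bordification.pt (g i • x)) atTop
        (@nhds _ (CATZero.coneTopology o) (CATZero.Bordification.bd p)) →
      Tendsto (fun i => CATZero.Bordification.pt ((g i)⁻¹ • x)) atTop
        (@nhds _ (CATZero.coneTopology o) (CATZero.Bordification.bd n)) →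
      CATZero.PiConverges o g n p) ∧
    (∀ g : ℕ → G, Function.Injective g →
      ∃ φ : ℕ → ℕ, StrictMono φ ∧ ∃ n p : CATZero.Boundary X,
        CATZero.PiConverges o (g ∘ φ) n p) := by
  refine ⟨fun x g n p hp hn => ?_, fun g hg => ?_⟩
  · obtain ⟨N, hN₀, rfl⟩ := hX.exists_ray o n
    obtain ⟨P, hP₀, rfl⟩ := hX.exists_ray o p
    -- The orbits of `x` and `o` stay at distance `dist x o`, so they have the same limits at
    -- infinity.
    exact piConverges_of_tendstoRay hX hN₀ hP₀
      ((TendstoRay.of_cone hX hP₀ hp).of_bounded hX fun i => (dist_smul (g i) x o).le)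
      ((TendstoRay.of_cone hX hN₀ hn).of_bounded hX fun i => (dist_smul (g i)⁻¹ x o).le)
  · obtain ⟨φ, hφ, P, hP₀, hP⟩ :=
      exists_subseq_tendstoRay hX (tendsto_dist_smul_of_injective hG o hg)
    obtain ⟨ψ, hψ, N, hN₀, hN⟩ := exists_subseq_tendstoRay hX
      (tendsto_dist_smul_of_injective hG o (inv_injective.comp (hg.comp hφ.injective)))
    refine ⟨φ ∘ ψ, hφ.comp hψ, Ray.endpoint N, Ray.endpoint P, ?_⟩
    exact piConverges_of_tendstoRay hX hN₀ hP₀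
      ⟨hP.1.comp hψ.tendsto_atTop, fun t => (hP.2 t).comp hψ.tendsto_atTop⟩ hN
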